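/- Let $\mathcal{H}_A,\mathcal{H}_B$ be finite-dimensional complex Hilbert spaces and $\mathcal{H}_{AB}=\mathcal{H}_A\otimes\mathcal{H}_B$. For a finite-dimensional Hilbert space $\mathcal{H}$ let $\mathcal{S}_{\le}(\mathcal{H})$ be the set of sub-normalized states, i.e. of positive semidefinite operators $\rho$ on $\mathcal{H}$ with $\operatorname{tr}\rho\le 1$. For positive semidefinite operators let $F(\rho,\sigma)=\|\sqrt\rho\sqrt\sigma\|_1$, where $\|R\|_1=\operatorname{tr}\sqrt{R^\dagger R}$. For $\rho,\sigma\in\mathcal{S}_{\le}(\mathcal{H})$ let $$P(\rho,\sigma)=\sqrt{1-\bar F(\rho,\sigma)^2},\qquad \bar F(\rho,\sigma)=F(\rho,\sigma)+\sqrt{(1-\operatorname{tr}\rho)(1-\operatorname{tr}\sigma)},$$ be the purified distance; $\rho$ and $\sigma$ are called $\varepsilon$-close, $\rho\approx_\varepsilon\sigma$, if $P(\rho,\sigma)\le\varepsilon$. For $\rho_{AB}\in\mathcal{S}_{\le}(\mathcal{H}_{AB})$ and $\sigma_B\in\mathcal{S}_{\le}(\mathcal{H}_B)$ let $$H_{\max}(A|B)_{\rho|\sigma}=\log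 F(\rho_{AB},\mathrm{id}_A\otimes\sigma_B)^2,\qquad H_{\max}(A|B)_\rho=\max_{\sigma_B\in\mathcal{S}_{\le}(\mathcal{H}_B)}H_{\max}(A|B)_{\rho|\sigma},$$ where $\log$ is the logarithm to base $2$ and $\log 0=-\infty$. For $\rho'_{AB}\in\mathcal{S}_{\le}(\mathcal{H}_{AB})$ write $H_{\max}(A|B)_{\rho|\rho'}$ for $H_{\max}(A|B)_{\rho|\sigma}$ with $\sigma_B=\rho'_B=\operatorname{tr}_A\rho'_{AB}$. Lemma. Let $0<\varepsilon\le 1$ and $\varepsilon'\in\mathbb{R}$, let $\rho_{AB},\rho'_{AB}\in\mathcal{S}_{\le}(\mathcal{H}_{AB})$, and suppose that $\rho'_{AB}\approx_{\varepsilon'}\rho_{AB}$. Then there is a state $\tilde\rho_{AB}\in\mathcal{S}_{\le}(\mathcal{H}_{AB})$ with $\tilde\rho_{AB}\approx_{\varepsilon+\varepsilon'}\rho'_{AB}$ such that $$H_{\max}(A|B)_{\tilde\rho}\le H_{\max}(A|B)_{\rho|\rho'}+\log\left(\frac{1}{1-\sqrt{1-\varepsilon^2}}\right).$$ -/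

import Mathlib

open scoped ComplexOrder MatrixOrder Kronecker

noncomputable section

namespace QuantumEntropy

/-! A finite-dimensional Hilbert space is `ℂ^n`, with `n` a finite type indexing an orthonormal
basis; operators on it are the matrices `Matrix n n ℂ`. The tensor product of the spaces with
index types `A` and `B` has the index type `A × B`. -/

/-- The set `S_≤` of sub-normalized states: positive semidefinite operators of trace at most 1. -/
def subnormalizedStates (n : Type*) [Fintype n] : Set (Matrix n n ℂ) :=
  {ρ | ρ.PosSemidef ∧ ρ.trace.re ≤ 1}

/-- The trace norm `‖R‖₁ = tr √(R† R)`. -/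
def traceNorm {n : Type*} [Fintype n] [DecidableEq n] (R : Matrix n n ℂ) : ℝ :=
  (CFC.sqrt (R.conjTranspose * R)).trace.re

/-- The fidelity `F(ρ, σ) = ‖√ρ √σ‖₁` of positive semidefinite operators. -/
def fidelity {n : Type*} [Fintype n] [DecidableEq n] (ρ σ : Matrix n n ℂ) : ℝ :=
  traceNorm (CFC.sqrt ρ * CFC.sqrt σ)

/-- The generalized fidelity `F(ρ, σ) + √((1 - tr ρ) (1 - tr σ))` of sub-normalized states. -/
def generalizedFidelity {n : Type*} [Fintype n] [DecidableEq n] (ρ σ : Matrix n n ℂ) : ℝ :=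
  fidelity ρ σ + Real.sqrt ((1 - ρ.trace.re) * (1 - σ.trace.re))

/-- The purified distance of sub-normalized states. -/
def purifiedDistance {n : Type*} [Fintype n] [DecidableEq n] (ρ σ : Matrix n n ℂ) : ℝ :=
  Real.sqrt (1 - generalizedFidelity ρ σ ^ 2)

/-- `ρ ≈_ε σ`: the purified distance of `ρ` and `σ` is at most `ε`. -/
def IsClose {n : Type*} [Fintype n] [DecidableEq n] (ε : ℝ) (ρ σ : Matrix n n ℂ) : Prop :=
  purifiedDistance ρ σ ≤ ε

/-- The reduced operator `ρ_B = tr_A ρ_AB`. -/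
def reducedB {A B : Type*} [Fintype A] (ρ : Matrix (A × B) (A × B) ℂ) : Matrix B B ℂ :=
  Matrix.of fun b b' => ∑ a, ρ (a, b) (a, b')

/-- The binary logarithm of a nonnegative real number, with `log 0 = -∞`. -/
def log₂ (x : ℝ) : EReal :=
  if x ≤ 0 then ⊥ else ((Real.logb 2 x : ℝ) : EReal)

/-- The relative max-entropy `H_max(A|B)_{ρ|σ} = log F(ρ_AB, id_A ⊗ σ_B)²`. -/
def relativeMaxEntropy {A B : Type*} [Fintype A] [Fintype B] [DecidableEq A] [DecidableEq B]
    (ρ : Matrix (A × B) (A × B) ℂ) (σ : Matrix B B ℂ) : EReal :=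
  log₂ (fidelity ρ ((1 : Matrix A A ℂ) ⊗ₖ σ) ^ 2)

/-- The max-entropy `H_max(A|B)_ρ`, the supremum of `H_max(A|B)_{ρ|σ}` over all sub-normalized
states `σ` on `B`. -/
def maxEntropy {A B : Type*} [Fintype A] [Fintype B] [DecidableEq A] [DecidableEq B]
    (ρ : Matrix (A × B) (A × B) ℂ) : EReal :=
  ⨆ σ ∈ subnormalizedStates B, relativeMaxEntropy ρ σ

end QuantumEntropy

end

/-! The state is obtained from `ρ` by a local filter on B: `ρt = K ρ K†` with `K = 1 ⊗ k`. Write σ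
for the marginal of `ρ'` on B, R = √ρ √(1 ⊗ σ), f = ‖R‖₁ and c = √(1 - ε²). Let N be the marginal of
|R| on B, rescaled to trace 1 - c, and k = √σ Q⁻¹ √σ, where Q is σ + N made invertible
(`exists_filter`).

Entropy: with L = Q⁻¹√σ, the fidelity of `ρt` with 1 ⊗ ω is ‖R (1 ⊗ L√ω)‖₁. By the Hölder bound
`traceNorm_mul_sq_le` and L†NL ≤ 1, its square is at most f²/(1 - c), for all ω at once.

Distance: k costs σ at most tr N = 1 - c in trace, so the unit vector of `ρ'` has overlap at least c
with its filtered image. A triangle inequality for angles adds √(1 - c²) = ε to the distance from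
`ρ'` to `ρ` (`purifiedDistance_conj_le`). -/

noncomputable section

namespace QuantumEntropy

open Matrix

/-! ### Kernel projections, contractions and polar decomposition -/

section SingleSystem

variable {n : Type*} [Fintype n] [DecidableEq n]

/-- The projection onto the kernel of a positive semidefinite matrix. -/
theorem exists_kernel_projection {W : Matrix n n ℂ} (hW : W.PosSemidef) :
    ∃ E : Matrix n n ℂ, E.PosSemidef ∧ E * E = E ∧ W * E = 0 ∧ (W + E).PosDef := by
  have hsa : IsSelfAdjoint W := hW.isHermitian
  have hc : ∀ f : ℝ → ℝ, ContinuousOn f (spectrum ℝ W) :=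
    fun f => Matrix.finite_real_spectrum.continuousOn f
  set g : ℝ → ℝ := fun x => if x = 0 then 1 else 0
  have hE : cfc g W * cfc g W = cfc g W := by
    rw [← cfc_mul g g W (hc _) (hc _)]
    congr 1; ext x; by_cases hx : x = 0 <;> simp [g, hx]
  have hEp : (cfc g W).PosSemidef := by
    have h1 : (cfc g W)ᴴ = cfc g W := (cfc_predicate g W : IsSelfAdjoint _)
    have := posSemidef_conjTranspose_mul_self (cfc g W)
    rwa [h1, hE] at this
  have hWid : W = cfc (fun x : ℝ => x) W := (cfc_id' ℝ W hsa).symm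
  refine ⟨cfc g W, hEp, hE, ?_, ?_⟩
  · nth_rewrite 1 [hWid]
    rw [← cfc_mul _ g W (hc _) (hc _), ← cfc_zero ℝ W]
    congr 1; ext x; by_cases hx : x = 0 <;> simp [g, hx]
  · refine (hW.add hEp).posDef_iff_isUnit.mpr ?_
    have h1 : (W + cfc g W) * cfc (fun x : ℝ => if x = 0 then 1 else x⁻¹) W = 1 := by
      nth_rewrite 1 [hWid]
      rw [← cfc_add W _ g (hc _) (hc _), ← cfc_mul _ _ W (hc _) (hc _), ← cfc_one ℝ W]
      congr 1; ext x; by_cases hx : x = 0 <;> simp [g, hx]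
    exact IsUnit.of_mul_eq_one _ h1

theorem trace_re_nonneg {n : Type*} [Fintype n] {X : Matrix n n ℂ} (hX : X.PosSemidef) : 0 ≤ X.trace.re :=
  (Complex.le_def.mp hX.trace_nonneg).1

/-- 1 - T is the sum of the positive operators (1 - T)² and T - T². -/
theorem le_one_of_mul_self_le {T : Matrix n n ℂ} (hT : T.IsHermitian) (h : T * T ≤ T) : T ≤ 1 := by
  have h1 : (T - T * T).PosSemidef := h
  have h2 := posSemidef_conjTranspose_mul_self (1 - T)
  have h3 : (1 - T)ᴴ = 1 - T := by simp [hT.eq]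
  rw [h3] at h2
  have h4 : (1 : Matrix n n ℂ) - T = (1 - T) * (1 - T) + (T - T * T) := by noncomm_ring
  rw [Matrix.le_iff, h4]
  exact h2.add h1

theorem mul_conjTranspose_le_one {U : Matrix n n ℂ} (hU : Uᴴ * U ≤ 1) : U * Uᴴ ≤ 1 := by
  refine le_one_of_mul_self_le (isHermitian_mul_conjTranspose_self U) ?_
  have h : (1 - Uᴴ * U).PosSemidef := hU
  have := h.mul_mul_conjTranspose_same U
  have h2 : U * Uᴴ - U * Uᴴ * (U * Uᴴ) = U * (1 - Uᴴ * U) * Uᴴ := by noncomm_ring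
  rw [Matrix.le_iff, h2]
  exact this

theorem posSemidef_sqrt (X : Matrix n n ℂ) : (CFC.sqrt X).PosSemidef :=
  (CFC.sqrt_nonneg X).posSemidef

theorem conjTranspose_sqrt (X : Matrix n n ℂ) : (CFC.sqrt X)ᴴ = CFC.sqrt X :=
  (posSemidef_sqrt X).isHermitian

theorem sqrt_mul_self_of_posSemidef {X : Matrix n n ℂ} (hX : X.PosSemidef) :
    CFC.sqrt X * CFC.sqrt X = X :=
  CFC.sqrt_mul_sqrt_self X hX.nonneg

/-- Polar decomposition, with a contraction `U`. -/
theorem exists_polar (R : Matrix n n ℂ) :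
    ∃ U : Matrix n n ℂ, Uᴴ * U ≤ 1 ∧ U * Uᴴ ≤ 1 ∧ R = U * CFC.sqrt (Rᴴ * R) ∧
      Uᴴ * R = CFC.sqrt (Rᴴ * R) := by
  set H := CFC.sqrt (Rᴴ * R)
  have hHp : H.PosSemidef := posSemidef_sqrt _
  have hHh : Hᴴ = H := hHp.isHermitian
  have hHH : H * H = Rᴴ * R := sqrt_mul_self_of_posSemidef (posSemidef_conjTranspose_mul_self R)
  obtain ⟨E, hEp, hEE, hHE, hW⟩ := exists_kernel_projection hHp
  have hEh : Eᴴ = E := hEp.isHermitian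
  have hEH : E * H = 0 := by
    have := congrArg conjTranspose hHE
    simpa [hEh, hHh] using this
  have hRE : R * E = 0 := by
    rw [← conjTranspose_mul_self_eq_zero]
    calc (R * E)ᴴ * (R * E) = E * (Rᴴ * R) * E := by
          rw [conjTranspose_mul, hEh]; noncomm_ring
      _ = 0 := by rw [← hHH, ← mul_assoc, hEH, zero_mul, zero_mul]
  have hdet : IsUnit (H + E).det := (isUnit_iff_isUnit_det _).mp hW.isUnit
  -- V inverts H off its kernel and is the identity on it, so R V is a partial isometry with initial
  -- projection 1 - E.
  set V := (H + E)⁻¹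
  have hVh : Vᴴ = V := hW.inv.isHermitian
  have hVW : V * (H + E) = 1 := nonsing_inv_mul _ hdet
  have hWV : (H + E) * V = 1 := mul_nonsing_inv _ hdet
  have hVE : V * E = E := by
    calc V * E = V * ((H + E) * E) := by rw [add_mul, hHE, hEE, zero_add]
      _ = E := by rw [← mul_assoc, hVW, one_mul]
  have hVH : V * H = 1 - E := by
    rw [← hVW, mul_add, hVE]; abel
  have hU : (R * V)ᴴ * (R * V) ≤ 1 := by
    have h1 : (R * V)ᴴ * (R * V) = 1 - E := by
      calc (R * V)ᴴ * (R * V) = V * (Rᴴ * R) * V := by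
            rw [conjTranspose_mul, hVh]; noncomm_ring
        _ = (1 - E) * (H * V) := by rw [← hHH, ← hVH]; noncomm_ring
        _ = (1 - E) * (V * H)ᴴ := by rw [conjTranspose_mul, hVh, hHh]
        _ = 1 - E := by
          rw [hVH, conjTranspose_sub, conjTranspose_one, hEh, sub_mul, mul_sub, mul_sub, hEE]
          simp
    rw [h1, Matrix.le_iff]
    simpa using hEp
  refine ⟨R * V, hU, mul_conjTranspose_le_one hU, ?_, ?_⟩
  · rw [mul_assoc, hVH, mul_sub, hRE]; simp
  · rw [conjTranspose_mul, hVh, mul_assoc, ← hHH, ← mul_assoc, hVH, sub_mul, hEH]; simp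

theorem trace_re_conj_le {U X : Matrix n n ℂ} (hX : X.PosSemidef) (hU : Uᴴ * U ≤ 1) :
    (U * X * Uᴴ).trace.re ≤ X.trace.re := by
  have h : (1 - Uᴴ * U).PosSemidef := hU
  have h1 := trace_re_nonneg (h.mul_mul_conjTranspose_same (CFC.sqrt X))
  have h2 : (CFC.sqrt X * (1 - Uᴴ * U) * (CFC.sqrt X)ᴴ).trace = X.trace - (U * X * Uᴴ).trace := by
    rw [conjTranspose_sqrt, mul_sub, sub_mul, trace_sub, mul_one, sqrt_mul_self_of_posSemidef hX,
      trace_mul_comm (U * X), trace_mul_comm (CFC.sqrt X * (Uᴴ * U)), ← mul_assoc, ← mul_assoc,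
      sqrt_mul_self_of_posSemidef hX, ← mul_assoc, trace_mul_comm, ← mul_assoc, trace_mul_comm,
      mul_assoc]
  rw [h2, Complex.sub_re] at h1
  linarith

/-! ### Hilbert-Schmidt vectors and the triangle inequality for angles -/

/-- A matrix together with a scalar, as a Hilbert-Schmidt vector. -/
def hsVec {n : Type*} [Fintype n] (X : Matrix n n ℂ) (r : ℝ) : EuclideanSpace ℂ ((n × n) ⊕ Unit) :=
  WithLp.toLp 2 (Sum.elim (fun p => X p.1 p.2) fun _ => (r : ℂ))

theorem inner_hsVec {n : Type*} [Fintype n] (X Y : Matrix n n ℂ) (r s : ℝ) :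
    inner ℝ (hsVec X r) (hsVec Y s) = (Xᴴ * Y).trace.re + r * s := by
  have h : inner ℂ (hsVec X r) (hsVec Y s) = (Xᴴ * Y).trace + r * s := by
    simp only [hsVec, PiLp.inner_apply, Fintype.sum_sum_type, Sum.elim_inl, Sum.elim_inr,
      Fintype.sum_prod_type, Matrix.trace, Matrix.diag, Matrix.mul_apply, conjTranspose_apply,
      RCLike.inner_apply, Finset.univ_unique, Finset.sum_singleton, Complex.conj_ofReal]
    rw [Finset.sum_comm]
    congr 1
    · exact Finset.sum_congr rfl fun _ _ => Finset.sum_congr rfl fun _ _ => mul_comm _ _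
    · exact mul_comm _ _
  have h2 : inner ℝ (hsVec X r) (hsVec Y s) = (inner ℂ (hsVec X r) (hsVec Y s)).re := by
    simp only [PiLp.inner_apply, Complex.re_sum]; rfl
  rw [h2, h]
  simp

theorem norm_sq_hsVec {n : Type*} [Fintype n] (X : Matrix n n ℂ) (r : ℝ) :
    ‖hsVec X r‖ ^ 2 = (Xᴴ * X).trace.re + r ^ 2 := by
  rw [← real_inner_self_eq_norm_sq, inner_hsVec, sq]

theorem trace_re_mul_le {n : Type*} [Fintype n] (X Y : Matrix n n ℂ) :
    (Xᴴ * Y).trace.re ^ 2 ≤ (Xᴴ * X).trace.re * (Yᴴ * Y).trace.re := by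
  have h := abs_real_inner_le_norm (hsVec X 0) (hsVec Y 0)
  have h2 := sq_le_sq' (abs_le.mp h).1 (abs_le.mp h).2
  rw [mul_pow, norm_sq_hsVec, norm_sq_hsVec, inner_hsVec] at h2
  simpa using h2

/-- This is cos(α + β) ≤ ⟨x, z⟩: apply Cauchy-Schwarz to the components of x and z orthogonal to y.
-/
theorem inner_ge_of_norm_le_one {V : Type*} [NormedAddCommGroup V] [InnerProductSpace ℝ V]
    {x y z : V} (hx : ‖x‖ ≤ 1) (hy : ‖y‖ = 1) (hz : ‖z‖ ≤ 1) :
    inner ℝ x y * inner ℝ y z - √(1 - inner ℝ x y ^ 2) * √(1 - inner ℝ y z ^ 2) ≤ inner ℝ x z := by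
  set a := inner ℝ x y
  set b := inner ℝ y z
  have hyy : inner ℝ y y = (1 : ℝ) := by rw [real_inner_self_eq_norm_sq, hy]; norm_num
  have hxz : inner ℝ (x - a • y) (z - b • y) = inner ℝ x z - a * b := by
    simp only [inner_sub_left, inner_sub_right, real_inner_smul_left, real_inner_smul_right, hyy]
    change _ - a * b - (b * a - _) = _
    ring
  have hnx : ‖x - a • y‖ ≤ √(1 - a ^ 2) := by
    refine Real.le_sqrt_of_sq_le ?_
    rw [norm_sub_sq_real, real_inner_smul_right, norm_smul, hy, mul_one, Real.norm_eq_abs, sq_abs]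
    change ‖x‖ ^ 2 - 2 * (a * a) + a ^ 2 ≤ _
    nlinarith [norm_nonneg x]
  have hnz : ‖z - b • y‖ ≤ √(1 - b ^ 2) := by
    refine Real.le_sqrt_of_sq_le ?_
    rw [norm_sub_sq_real, real_inner_smul_right, norm_smul, hy, mul_one, Real.norm_eq_abs, sq_abs,
      real_inner_comm]
    change ‖z‖ ^ 2 - 2 * (b * b) + b ^ 2 ≤ _
    nlinarith [norm_nonneg z]
  have h := (abs_le.mp (abs_real_inner_le_norm (x - a • y) (z - b • y))).1
  rw [hxz] at h
  have := mul_le_mul hnx hnz (norm_nonneg _) (Real.sqrt_nonneg _)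
  linarith

/-- With a = cos α and b = cos β, this is subadditivity of the sine. -/
theorem sqrt_one_sub_sq_le {a b q : ℝ} (ha : 0 ≤ a) (ha1 : a ≤ 1) (hb : 0 ≤ b) (hb1 : b ≤ 1)
    (h : a * b - √(1 - a ^ 2) * √(1 - b ^ 2) ≤ q) :
    √(1 - q ^ 2) ≤ √(1 - a ^ 2) + √(1 - b ^ 2) := by
  have hs := Real.sq_sqrt (show 0 ≤ 1 - a ^ 2 by nlinarith)
  have ht := Real.sq_sqrt (show 0 ≤ 1 - b ^ 2 by nlinarith)
  have hs0 := Real.sqrt_nonneg (1 - a ^ 2)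
  have ht0 := Real.sqrt_nonneg (1 - b ^ 2)
  set s := √(1 - a ^ 2)
  set t := √(1 - b ^ 2)
  refine Real.sqrt_le_iff.mpr ⟨by positivity, ?_⟩
  have hab : a ^ 2 * b ^ 2 = (1 - s ^ 2) * (1 - t ^ 2) := by rw [hs, ht]; ring
  rcases le_total (s * t) (a * b) with hc | hc
  · have h1 : (a * b - s * t) ^ 2 ≤ q ^ 2 := pow_le_pow_left₀ (by linarith) h 2
    have h2 : a * b ≤ 1 := by nlinarith
    nlinarith [mul_nonneg hs0 ht0, mul_nonneg (mul_nonneg hs0 ht0) (sub_nonneg.2 h2)]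
  -- Here cos(α + β) ≤ 0, which forces s² + t² ≥ 1, so the bound holds for every q.
  · have h1 : (a * b) ^ 2 ≤ (s * t) ^ 2 := pow_le_pow_left₀ (by positivity) hc 2
    nlinarith [mul_nonneg hs0 ht0, sq_nonneg q]

/-! ### Variational form of the trace norm -/

theorem traceNorm_nonneg (R : Matrix n n ℂ) : 0 ≤ traceNorm R :=
  trace_re_nonneg (posSemidef_sqrt _)

theorem exists_traceNorm_eq (R : Matrix n n ℂ) :
    ∃ U : Matrix n n ℂ, Uᴴ * U ≤ 1 ∧ U * Uᴴ ≤ 1 ∧ (Uᴴ * R).trace.re = traceNorm R := by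
  obtain ⟨U, h1, h2, -, h3⟩ := exists_polar R
  exact ⟨U, h1, h2, by rw [h3]; rfl⟩

/-- Write R = U H and split H as s s; Cauchy-Schwarz for V U s and s leaves two factors at most tr
H, since U and V are contractions. -/
theorem trace_re_mul_le_traceNorm {V : Matrix n n ℂ} (hV : V * Vᴴ ≤ 1) (R : Matrix n n ℂ) :
    (V * R).trace.re ≤ traceNorm R := by
  obtain ⟨U, h1, h2, h3, -⟩ := exists_polar R
  have hH := posSemidef_sqrt (Rᴴ * R)
  change _ ≤ (CFC.sqrt (Rᴴ * R)).trace.re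
  generalize CFC.sqrt (Rᴴ * R) = H at *
  have hH0 := trace_re_nonneg hH
  have hs := sqrt_mul_self_of_posSemidef hH
  have hsh := conjTranspose_sqrt H
  set s := CFC.sqrt H
  have hcs := trace_re_mul_le ((V * U * s)ᴴ) s
  have e1 : (((V * U * s)ᴴ)ᴴ * s).trace = (V * R).trace := by
    rw [conjTranspose_conjTranspose, mul_assoc, hs, h3, mul_assoc]
  have e2 : (((V * U * s)ᴴ)ᴴ * (V * U * s)ᴴ).trace = (V * (U * H * Uᴴ) * Vᴴ).trace := by
    rw [conjTranspose_conjTranspose, ← hs]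
    simp only [conjTranspose_mul, hsh, mul_assoc]
  have hVV : Vᴴ * V ≤ 1 := by simpa using mul_conjTranspose_le_one (U := Vᴴ) (by simpa using hV)
  have e3 := (trace_re_conj_le (hH.mul_mul_conjTranspose_same U) hVV).trans (trace_re_conj_le hH h1)
  rw [e1, e2, hsh, hs] at hcs
  refine le_of_abs_le (abs_le_of_sq_le_sq ?_ hH0)
  nlinarith

/-! ### The filter, its fidelity and its purified distance -/

theorem re_trace_mul_nonneg {X Y : Matrix n n ℂ} (hX : X.PosSemidef) (hY : Y.PosSemidef) :
    0 ≤ (X * Y).trace.re := by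
  have h := trace_re_nonneg (hX.mul_mul_conjTranspose_same (CFC.sqrt Y))
  rwa [conjTranspose_sqrt, mul_assoc, trace_mul_comm, mul_assoc,
    sqrt_mul_self_of_posSemidef hY] at h

/-- The filter `k = √σ Q⁻¹ √σ`, where `Q` is `σ + N` made invertible. -/
theorem exists_filter {σ N : Matrix n n ℂ} (hσ : σ.PosSemidef) (hN : N.PosSemidef) :
    ∃ k L : Matrix n n ℂ, k.PosSemidef ∧ k * k ≤ 1 ∧ k = CFC.sqrt σ * L ∧ Lᴴ * N * L ≤ 1 ∧
      σ.trace.re - (k * σ).trace.re ≤ N.trace.re := by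
  obtain ⟨E, hE, hEE, hWE, hQ⟩ := exists_kernel_projection (hσ.add hN)
  have hEh : Eᴴ = E := hE.isHermitian
  have hEW : E * (σ + N) = 0 := by
    have := congrArg conjTranspose hWE
    rwa [conjTranspose_mul, hEh, (hσ.add hN).isHermitian.eq, conjTranspose_zero] at this
  have hdet : IsUnit (σ + N + E).det := (isUnit_iff_isUnit_det _).mp hQ.isUnit
  set Q := σ + N + E with hQdef
  have hVQ : Q⁻¹ * Q = 1 := nonsing_inv_mul _ hdet
  have hQV : Q * Q⁻¹ = 1 := mul_nonsing_inv _ hdet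
  have hVp : Q⁻¹.PosSemidef := hQ.inv.posSemidef
  have hVh : (Q⁻¹)ᴴ = Q⁻¹ := hVp.isHermitian
  set V := Q⁻¹
  have hVE : V * E = E := by
    calc V * E = V * (Q * E) := by rw [hQdef, add_mul (σ + N), hWE, hEE, zero_add]
      _ = E := by rw [← mul_assoc, hVQ, one_mul]
  have hEV : E * V = E := by
    have := congrArg conjTranspose hVE
    rwa [conjTranspose_mul, hEh, hVh] at this
  have hss := sqrt_mul_self_of_posSemidef hσ
  have hsh := conjTranspose_sqrt σ
  set s := CFC.sqrt σ
  have hLh : (V * s)ᴴ = s * V := by rw [conjTranspose_mul, hVh, hsh]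
  have hkp : (s * V * s).PosSemidef := by
    have := hVp.mul_mul_conjTranspose_same s
    rwa [hsh] at this
  -- k - k² = L†(N + E)L, because N + E = Q - σ.
  have hk1 : s * V * s * (s * V * s) ≤ s * V * s := by
    have h := (hN.add hE).conjTranspose_mul_mul_same (V * s)
    have e : s * V * s - s * V * s * (s * V * s) = (V * s)ᴴ * (N + E) * (V * s) := by
      have : N + E = Q - s * s := by rw [hss, hQdef]; abel
      rw [hLh, this]
      calc _ = s * V * 1 * s - s * V * s * (s * V * s) := by rw [mul_one]
        _ = _ := by rw [← hQV]; noncomm_ring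
    rw [Matrix.le_iff, e]; exact h
  have hk2 : s * V * s ≤ 1 := le_one_of_mul_self_le hkp.isHermitian hk1
  refine ⟨s * V * s, V * s, hkp, hk1.trans hk2, mul_assoc _ _ _, ?_, ?_⟩
  · refine le_trans ?_ hk2
    have h := (hσ.add hE).conjTranspose_mul_mul_same (V * s)
    have e : s * V * s - (V * s)ᴴ * N * (V * s) = (V * s)ᴴ * (σ + E) * (V * s) := by
      have : σ + E = Q - N := by rw [hQdef]; abel
      rw [hLh, this]
      calc _ = s * V * 1 * s - s * V * N * (V * s) := by rw [mul_one, mul_assoc (s * V) N]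
        _ = _ := by rw [← hQV]; noncomm_ring
    rw [Matrix.le_iff, e]; exact h
  · have e1 : (s * V * s * σ).trace = (σ * V * σ).trace := by
      rw [← hss, ← mul_assoc, trace_mul_comm]
      simp only [mul_assoc]
    -- As tr Eσ = -tr EN, the trace of this is tr N - tr NVN - 2 tr EN, at most tr N.
    have e2 : σ - σ * V * σ = N - N * V * N - E * N + σ * E := by
      have hσQ : σ = Q - N - E := by rw [hQdef]; abel
      calc σ - σ * V * σ = σ * (V * Q) - σ * V * σ := by rw [hVQ, mul_one]
        _ = σ * V * N + σ * (V * E) := by rw [hQdef]; noncomm_ring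
        _ = σ * V * N + σ * E := by rw [hVE]
        _ = (Q - N - E) * V * N + σ * E := by rw [← hσQ]
        _ = (Q * V) * N - N * V * N - (E * V) * N + σ * E := by noncomm_ring
        _ = _ := by rw [hQV, hEV, one_mul]
    have e3 : (E * σ).trace.re + (E * N).trace.re = 0 := by
      rw [← Complex.add_re, ← trace_add, ← mul_add, hEW]; simp
    have h1 := re_trace_mul_nonneg hE hN
    have h2 := trace_re_nonneg (hVp.mul_mul_conjTranspose_same N)
    rw [hN.isHermitian.eq] at h2
    have e4 := congrArg (fun X => X.trace.re) e2
    simp only [trace_add, trace_sub, Complex.add_re, Complex.sub_re] at e4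
    rw [trace_mul_comm σ E] at e4
    rw [e1, e4]
    linarith

theorem traceNorm_congr {R R' : Matrix n n ℂ} (h : Rᴴ * R = R'ᴴ * R') :
    traceNorm R = traceNorm R' := by
  rw [traceNorm, traceNorm, h]

/-- Filtering the first argument of the fidelity. -/
theorem fidelity_conj {ρ σ K : Matrix n n ℂ} (hρ : ρ.PosSemidef) :
    fidelity (K * ρ * Kᴴ) σ = traceNorm (CFC.sqrt ρ * Kᴴ * CFC.sqrt σ) := by
  -- Both operators have the same R†R, namely √σ K ρ K† √σ.
  refine traceNorm_congr ?_
  rw [conjTranspose_mul, conjTranspose_mul, conjTranspose_mul, conjTranspose_sqrt,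
    conjTranspose_sqrt, conjTranspose_sqrt, conjTranspose_conjTranspose]
  calc _ = CFC.sqrt σ * (CFC.sqrt (K * ρ * Kᴴ) * CFC.sqrt (K * ρ * Kᴴ)) * CFC.sqrt σ := by
        noncomm_ring
    _ = CFC.sqrt σ * (K * (CFC.sqrt ρ * CFC.sqrt ρ) * Kᴴ) * CFC.sqrt σ := by
        rw [sqrt_mul_self_of_posSemidef (hρ.mul_mul_conjTranspose_same K),
          sqrt_mul_self_of_posSemidef hρ]
    _ = _ := by noncomm_ring

/-- A Hölder inequality for the trace norm. -/
theorem traceNorm_mul_sq_le (R D : Matrix n n ℂ) :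
    traceNorm (R * D) ^ 2 ≤ traceNorm R * (Dᴴ * CFC.sqrt (Rᴴ * R) * D).trace.re := by
  obtain ⟨V, hV1, hV2, hV⟩ := exists_traceNorm_eq (R * D)
  obtain ⟨U, hU1, hU2, hR, -⟩ := exists_polar R
  have hH := posSemidef_sqrt (Rᴴ * R)
  change _ ≤ (CFC.sqrt (Rᴴ * R)).trace.re * _
  generalize CFC.sqrt (Rᴴ * R) = H at *
  have hs := sqrt_mul_self_of_posSemidef hH
  have hsh := conjTranspose_sqrt H
  set s := CFC.sqrt H
  have hcs := trace_re_mul_le ((Vᴴ * U * s)ᴴ) (s * D)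
  have e1 : ((Vᴴ * U * s)ᴴ)ᴴ * (s * D) = Vᴴ * (R * D) := by
    rw [conjTranspose_conjTranspose, hR, ← hs]; simp only [mul_assoc]
  have e2 : ((Vᴴ * U * s)ᴴ)ᴴ * (Vᴴ * U * s)ᴴ = Vᴴ * (U * H * Uᴴ) * (Vᴴ)ᴴ := by
    rw [conjTranspose_conjTranspose, ← hs]
    simp only [conjTranspose_mul, hsh, mul_assoc, conjTranspose_conjTranspose]
  have e3 : (s * D)ᴴ * (s * D) = Dᴴ * H * D := by
    rw [conjTranspose_mul, hsh, ← hs]; simp only [mul_assoc]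
  rw [e1, e2, e3, hV] at hcs
  refine hcs.trans (mul_le_mul_of_nonneg_right ?_ ?_)
  · exact (trace_re_conj_le (hH.mul_mul_conjTranspose_same U) (by simpa using hV2)).trans
      (trace_re_conj_le hH hU1)
  · exact trace_re_nonneg (hH.conjTranspose_mul_mul_same D)

/-- Filtering by `K` with `tr K σ` close to `tr σ`. -/
theorem purifiedDistance_conj_le {ρ σ K : Matrix n n ℂ} (hρ : ρ ∈ subnormalizedStates n)
    (hσ : σ ∈ subnormalizedStates n) (hK : K.PosSemidef) (hK1 : K * K ≤ 1) {c : ℝ} (hc : 0 ≤ c)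
    (h : σ.trace.re - (K * σ).trace.re ≤ 1 - c) :
    purifiedDistance (K * ρ * Kᴴ) σ ≤ √(1 - c ^ 2) + purifiedDistance σ ρ := by
  obtain ⟨U, hU1, hU2, hU⟩ := exists_traceNorm_eq (CFC.sqrt σ * CFC.sqrt ρ)
  have hKh : Kᴴ = K := hK.isHermitian
  have hKK : Kᴴ * K ≤ 1 := by rwa [hKh]
  have hF : (U * (CFC.sqrt ρ * Kᴴ * CFC.sqrt σ)).trace.re ≤ fidelity (K * ρ * Kᴴ) σ := by
    rw [fidelity_conj hρ.1]; exact trace_re_mul_le_traceNorm hU2 _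
  have htK := trace_re_conj_le hρ.1 hKK
  have hsρ := sqrt_mul_self_of_posSemidef hρ.1
  have hsρh := conjTranspose_sqrt ρ
  have hsσ := sqrt_mul_self_of_posSemidef hσ.1
  have hsσh := conjTranspose_sqrt σ
  have hU' : (U * CFC.sqrt ρ * CFC.sqrt σ).trace.re = fidelity σ ρ := by
    rw [fidelity, ← hU, ← Complex.conj_re, ← Complex.star_def, ← trace_conjTranspose]
    simp only [conjTranspose_mul, hsρh, hsσh, mul_assoc]
    rw [← mul_assoc, trace_mul_comm]
  set sρ := CFC.sqrt ρ
  set sσ := CFC.sqrt σ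
  have hr := hρ.2
  have ht := hσ.2
  have hr0 := Real.sq_sqrt (sub_nonneg.2 hr)
  have ht0 := Real.sq_sqrt (sub_nonneg.2 ht)
  -- The three vectors are x from U√ρ, y from √σ and z from K√σ, the last keeping the scalar entry
  -- of y.
  have hnx : ‖hsVec (U * sρ)ᴴ √(1 - ρ.trace.re)‖ ≤ 1 := by
    rw [← sq_le_one_iff₀ (norm_nonneg _), norm_sq_hsVec, hr0]
    have := trace_re_conj_le hρ.1 hU1
    have e : ((U * sρ)ᴴ)ᴴ * (U * sρ)ᴴ = U * ρ * Uᴴ := by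
      rw [conjTranspose_conjTranspose, conjTranspose_mul, hsρh, ← hsρ]; simp only [mul_assoc]
    rw [e]; linarith
  have hny : ‖hsVec sσ √(1 - σ.trace.re)‖ = 1 := by
    rw [← sq_eq_sq₀ (norm_nonneg _) zero_le_one, norm_sq_hsVec, ht0, hsσh, hsσ]; ring
  have hnz : ‖hsVec (K * sσ) √(1 - σ.trace.re)‖ ≤ 1 := by
    rw [← sq_le_one_iff₀ (norm_nonneg _), norm_sq_hsVec, ht0]
    have := trace_re_conj_le hσ.1 hKK
    have e : ((K * sσ)ᴴ * (K * sσ)).trace = (K * σ * Kᴴ).trace := by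
      rw [trace_mul_comm, conjTranspose_mul, hsσh, ← hsσ]; simp only [mul_assoc]
    rw [e]; linarith
  have hin := inner_ge_of_norm_le_one hnx hny hnz
  have hxy1 := real_inner_le_norm (hsVec (U * sρ)ᴴ √(1 - ρ.trace.re)) (hsVec sσ √(1 - σ.trace.re))
  have hyz1 := real_inner_le_norm (hsVec sσ √(1 - σ.trace.re)) (hsVec (K * sσ) √(1 - σ.trace.re))
  rw [hny, mul_one] at hxy1
  rw [hny, one_mul] at hyz1
  replace hxy1 := hxy1.trans hnx
  replace hyz1 := hyz1.trans hnz
  have exy : inner ℝ (hsVec (U * sρ)ᴴ √(1 - ρ.trace.re)) (hsVec sσ √(1 - σ.trace.re))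
      = generalizedFidelity σ ρ := by
    rw [inner_hsVec, conjTranspose_conjTranspose, hU', generalizedFidelity,
      Real.sqrt_mul (sub_nonneg.2 ht), mul_comm √(1 - ρ.trace.re)]
  have hbc : c ≤ inner ℝ (hsVec sσ √(1 - σ.trace.re)) (hsVec (K * sσ) √(1 - σ.trace.re)) := by
    rw [inner_hsVec, ← sq, ht0, hsσh, ← mul_assoc, trace_mul_comm, ← mul_assoc, hsσ,
      trace_mul_comm]
    linarith
  -- In ⟨x, z⟩ the filter can be read as acting on ρ instead of σ; the scalar part only grows, since
  -- filtering lowers tr ρ.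
  have hxz : inner ℝ (hsVec (U * sρ)ᴴ √(1 - ρ.trace.re)) (hsVec (K * sσ) √(1 - σ.trace.re))
      ≤ generalizedFidelity (K * ρ * Kᴴ) σ := by
    rw [inner_hsVec, conjTranspose_conjTranspose, generalizedFidelity,
      Real.sqrt_mul (by linarith)]
    have e : U * sρ * (K * sσ) = U * (sρ * Kᴴ * sσ) := by rw [hKh]; simp only [mul_assoc]
    rw [e]
    refine add_le_add hF (mul_le_mul_of_nonneg_right (Real.sqrt_le_sqrt ?_) (Real.sqrt_nonneg _))
    linarith
  rw [exy] at hin hxy1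
  have ha0 : 0 ≤ generalizedFidelity σ ρ := add_nonneg (traceNorm_nonneg _) (Real.sqrt_nonneg _)
  have := sqrt_one_sub_sq_le ha0 hxy1 (hc.trans hbc) hyz1 (hin.trans hxz)
  have h3 : √(1 - inner ℝ (hsVec sσ √(1 - σ.trace.re)) (hsVec (K * sσ) √(1 - σ.trace.re)) ^ 2)
      ≤ √(1 - c ^ 2) :=
    Real.sqrt_le_sqrt (sub_le_sub_left (pow_le_pow_left₀ hc hbc 2) 1)
  rw [purifiedDistance, purifiedDistance]
  linarith

end SingleSystem

/-! ### Partial trace and filtering on B -/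

section Bipartite

variable {A B : Type*} [Fintype A]

theorem posSemidef_reducedB {ρ : Matrix (A × B) (A × B) ℂ} (hρ : ρ.PosSemidef) :
    (reducedB ρ).PosSemidef := by
  have h : reducedB ρ = ∑ a, ρ.submatrix (Prod.mk a) (Prod.mk a) := by
    ext b b'; simp [reducedB, Matrix.sum_apply]
  rw [h]
  exact posSemidef_sum _ fun a _ => hρ.submatrix _

variable [Fintype B]

theorem trace_reducedB (ρ : Matrix (A × B) (A × B) ℂ) : (reducedB ρ).trace = ρ.trace := by
  simp only [reducedB, Matrix.trace, Matrix.diag, Matrix.of_apply, Fintype.sum_prod_type]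
  exact Finset.sum_comm

variable [DecidableEq A]

theorem trace_one_kronecker_mul (X : Matrix B B ℂ) (Z : Matrix (A × B) (A × B) ℂ) :
    (((1 : Matrix A A ℂ) ⊗ₖ X) * Z).trace = (X * reducedB Z).trace := by
  simp only [Matrix.trace, Matrix.diag, Matrix.mul_apply, Fintype.sum_prod_type, reducedB,
    Matrix.of_apply, kronecker_apply, Matrix.one_apply, ite_mul, one_mul, zero_mul,
    Finset.mul_sum]
  simp only [← Finset.sum_comm (s := (Finset.univ : Finset B)) (t := (Finset.univ : Finset A)),
    Finset.sum_ite_eq, Finset.mem_univ, if_true]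

variable [DecidableEq B]

theorem sqrt_one_kronecker {σ : Matrix B B ℂ} (hσ : σ.PosSemidef) :
    CFC.sqrt ((1 : Matrix A A ℂ) ⊗ₖ σ) = 1 ⊗ₖ CFC.sqrt σ := by
  refine CFC.sqrt_unique ?_ (PosSemidef.one.kronecker (posSemidef_sqrt σ)).nonneg
  rw [← mul_kronecker_mul, one_mul, sqrt_mul_self_of_posSemidef hσ]

theorem one_kronecker_le_one {X : Matrix B B ℂ} (hX : X ≤ 1) : (1 : Matrix A A ℂ) ⊗ₖ X ≤ 1 := by
  have h : (1 - X).PosSemidef := hX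
  have e : (1 : Matrix (A × B) (A × B) ℂ) - 1 ⊗ₖ X = (1 : Matrix A A ℂ) ⊗ₖ (1 - X) := by
    rw [eq_comm, eq_sub_iff_add_eq, ← kronecker_add, sub_add_cancel, one_kronecker_one]
  rw [Matrix.le_iff, e]
  exact PosSemidef.one.kronecker h

/-- The filtered state has a uniformly small fidelity with all `id ⊗ ω`. -/
theorem fidelity_filter_sq_le {ρ : Matrix (A × B) (A × B) ℂ} {σ ω L : Matrix B B ℂ}
    (hρ : ρ.PosSemidef) (hσ : σ.PosSemidef) (hω : ω ∈ subnormalizedStates B)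
    {k : Matrix B B ℂ} (hk : k.IsHermitian) (hkL : k = CFC.sqrt σ * L) {r : ℝ} (hr : 0 ≤ r)
    (hL : Lᴴ * (r • reducedB (CFC.sqrt ((CFC.sqrt ρ * CFC.sqrt ((1 : Matrix A A ℂ) ⊗ₖ σ))ᴴ *
      (CFC.sqrt ρ * CFC.sqrt ((1 : Matrix A A ℂ) ⊗ₖ σ))))) * L ≤ 1) :
    r * fidelity (((1 : Matrix A A ℂ) ⊗ₖ k) * ρ * ((1 : Matrix A A ℂ) ⊗ₖ k)ᴴ)
      ((1 : Matrix A A ℂ) ⊗ₖ ω) ^ 2 ≤ fidelity ρ ((1 : Matrix A A ℂ) ⊗ₖ σ) := by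
  have hKh : ((1 : Matrix A A ℂ) ⊗ₖ k)ᴴ = 1 ⊗ₖ k := by
    rw [conjTranspose_kronecker, hk.eq, conjTranspose_one]
  -- The factor √σ of k turns √ρ into R, leaving L√ω on B.
  have hfac : CFC.sqrt ρ * ((1 : Matrix A A ℂ) ⊗ₖ k)ᴴ * CFC.sqrt ((1 : Matrix A A ℂ) ⊗ₖ ω) =
      CFC.sqrt ρ * CFC.sqrt ((1 : Matrix A A ℂ) ⊗ₖ σ) * (1 ⊗ₖ (L * CFC.sqrt ω)) := by
    rw [hKh, sqrt_one_kronecker hσ, sqrt_one_kronecker hω.1, mul_assoc, mul_assoc,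
      ← mul_kronecker_mul, ← mul_kronecker_mul, hkL, mul_assoc]
  rw [fidelity_conj hρ, hfac]
  have hH := traceNorm_mul_sq_le (CFC.sqrt ρ * CFC.sqrt ((1 : Matrix A A ℂ) ⊗ₖ σ))
    ((1 : Matrix A A ℂ) ⊗ₖ (L * CFC.sqrt ω))
  change _ ≤ traceNorm (CFC.sqrt ρ * CFC.sqrt ((1 : Matrix A A ℂ) ⊗ₖ σ))
  have hF := traceNorm_nonneg (CFC.sqrt ρ * CFC.sqrt ((1 : Matrix A A ℂ) ⊗ₖ σ))
  generalize CFC.sqrt ρ * CFC.sqrt ((1 : Matrix A A ℂ) ⊗ₖ σ) = R at *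
  generalize CFC.sqrt (Rᴴ * R) = H at *
  have e : (((1 : Matrix A A ℂ) ⊗ₖ (L * CFC.sqrt ω))ᴴ * H * (1 ⊗ₖ (L * CFC.sqrt ω))).trace =
      (Lᴴ * reducedB H * L * ω).trace := by
    rw [trace_mul_comm, ← mul_assoc, conjTranspose_kronecker, ← mul_kronecker_mul,
      conjTranspose_one, one_mul, trace_one_kronecker_mul, conjTranspose_mul, conjTranspose_sqrt]
    calc _ = (L * (CFC.sqrt ω * CFC.sqrt ω) * (Lᴴ * reducedB H)).trace := by
          simp only [mul_assoc]
      _ = _ := by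
          rw [sqrt_mul_self_of_posSemidef hω.1, trace_mul_comm]; simp only [mul_assoc]
  rw [e] at hH
  have h1 : (1 - Lᴴ * (r • reducedB H) * L).PosSemidef := hL
  have h2 := re_trace_mul_nonneg h1 hω.1
  rw [sub_mul, trace_sub, one_mul, mul_smul_comm, smul_mul_assoc, smul_mul_assoc, trace_smul,
    Complex.sub_re, Complex.real_smul, Complex.re_ofReal_mul] at h2
  have h3 := hω.2
  calc _ ≤ r * (traceNorm R * (Lᴴ * reducedB H * L * ω).trace.re) :=
        mul_le_mul_of_nonneg_left hH hr
    _ = traceNorm R * (r * (Lᴴ * reducedB H * L * ω).trace.re) := by ring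
    _ ≤ traceNorm R * 1 := mul_le_mul_of_nonneg_left (by linarith) hF
    _ = _ := mul_one _

theorem exists_close_fidelity_le {ρ σ : Matrix (A × B) (A × B) ℂ}
    (hρ : ρ ∈ subnormalizedStates (A × B)) (hσ : σ ∈ subnormalizedStates (A × B))
    {c : ℝ} (hc : 0 ≤ c) (hc1 : c < 1) :
    ∃ ρt ∈ subnormalizedStates (A × B),
      purifiedDistance ρt σ ≤ √(1 - c ^ 2) + purifiedDistance σ ρ ∧
      ∀ ω ∈ subnormalizedStates B, fidelity ρt ((1 : Matrix A A ℂ) ⊗ₖ ω) ^ 2 ≤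
        fidelity ρ ((1 : Matrix A A ℂ) ⊗ₖ reducedB σ) ^ 2 * (1 / (1 - c)) := by
  have hσB := posSemidef_reducedB hσ.1
  set R := CFC.sqrt ρ * CFC.sqrt ((1 : Matrix A A ℂ) ⊗ₖ reducedB σ) with hR
  have hM := posSemidef_reducedB (posSemidef_sqrt (Rᴴ * R))
  have hMt : (reducedB (CFC.sqrt (Rᴴ * R))).trace.re = traceNorm R := by
    rw [trace_reducedB]; rfl
  set f := traceNorm R with hf
  have hf0 : 0 ≤ f := traceNorm_nonneg R
  have hd : 0 < 1 - c := sub_pos.2 hc1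
  -- This weight gives N trace 1 - c; if f = 0 it is 0 by convention and N vanishes.
  have hr : 0 ≤ (1 - c) / f := by positivity
  obtain ⟨k, L, hk, hk1, hkL, hL, ht⟩ := exists_filter hσB (hM.smul hr)
  have hKp : ((1 : Matrix A A ℂ) ⊗ₖ k).PosSemidef := PosSemidef.one.kronecker hk
  have hKK : ((1 : Matrix A A ℂ) ⊗ₖ k) * (1 ⊗ₖ k) ≤ 1 := by
    rw [← mul_kronecker_mul, one_mul]; exact one_kronecker_le_one hk1
  refine ⟨((1 : Matrix A A ℂ) ⊗ₖ k) * ρ * ((1 : Matrix A A ℂ) ⊗ₖ k)ᴴ, ⟨?_, ?_⟩, ?_, ?_⟩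
  · exact hρ.1.mul_mul_conjTranspose_same _
  · exact (trace_re_conj_le hρ.1 (by rwa [hKp.isHermitian.eq])).trans hρ.2
  · refine purifiedDistance_conj_le hρ hσ hKp hKK hc ?_
    rw [trace_one_kronecker_mul, ← trace_reducedB σ]
    refine ht.trans ?_
    rw [trace_smul, Complex.real_smul, Complex.re_ofReal_mul, hMt]
    rcases eq_or_lt_of_le hf0 with h | h
    · rw [← h]; simpa using hc1.le
    · rw [div_mul_cancel₀ _ h.ne']
  · intro ω hω
    change _ ≤ f ^ 2 * _
    rcases eq_or_lt_of_le hf0 with h | h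
    -- For f = 0 the marginal of |R| is zero, so the filter bound holds with r = 1 and the new
    -- fidelity vanishes.
    · have h0 : reducedB (CFC.sqrt (Rᴴ * R)) = 0 := by
        refine hM.trace_eq_zero_iff.mp ?_
        have him := (Complex.le_def.mp hM.trace_nonneg).2
        exact Complex.ext (hMt.trans h.symm) him.symm
      rw [← h]
      have h1 := fidelity_filter_sq_le hρ.1 hσB hω hk.isHermitian hkL zero_le_one
        (by rw [← hR, h0]; simp [zero_le_one])
      change _ ≤ f at h1
      rw [← h] at h1
      simpa using h1
    · have h1 := fidelity_filter_sq_le hρ.1 hσB hω hk.isHermitian hkL hr hL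
      change _ ≤ f at h1
      rw [div_mul_eq_mul_div, div_le_iff₀ h] at h1
      rw [mul_one_div, le_div_iff₀ hd]
      linarith

/-- If x ≤ 0 the left side is ⊥; otherwise y > 0 is forced and real logarithms apply. -/
theorem log₂_le_log₂_add {x y t : ℝ} (ht : 0 < t) (h : x ≤ y * t) :
    log₂ x ≤ log₂ y + ((Real.logb 2 t : ℝ) : EReal) := by
  by_cases hx : x ≤ 0
  · simp [log₂, hx]
  · have hx' : 0 < x := not_le.mp hx
    have hy : 0 < y := pos_of_mul_pos_left (hx'.trans_le h) ht.le
    rw [log₂, log₂, if_neg hx, if_neg hy.not_ge, ← EReal.coe_add, EReal.coe_le_coe_iff,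
      ← Real.logb_mul hy.ne' ht.ne']
    exact Real.logb_le_logb_of_le one_lt_two hx' h

end Bipartite

end QuantumEntropy

end

theorem mainTheorem7 {A B : Type*} [Fintype A] [Fintype B] [DecidableEq A] [DecidableEq B]
    (ε ε' : ℝ) (hε : 0 < ε) (hε1 : ε ≤ 1)
    (ρ ρ' : Matrix (A × B) (A × B) ℂ)
    (hρ : ρ ∈ QuantumEntropy.subnormalizedStates (A × B))
    (hρ' : ρ' ∈ QuantumEntropy.subnormalizedStates (A × B))
    (hclose : QuantumEntropy.IsClose ε' ρ' ρ) :
    ∃ ρt ∈ QuantumEntropy.subnormalizedStates (A × B),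
      QuantumEntropy.IsClose (ε + ε') ρt ρ' ∧
      QuantumEntropy.maxEntropy ρt ≤
        QuantumEntropy.relativeMaxEntropy ρ (QuantumEntropy.reducedB ρ') +
          ((Real.logb 2 (1 / (1 - Real.sqrt (1 - ε ^ 2))) : ℝ) : EReal) := by
  have h0 : 0 ≤ 1 - ε ^ 2 := by nlinarith
  have hc1 : √(1 - ε ^ 2) < 1 := by
    rw [Real.sqrt_lt' one_pos]; nlinarith
  -- The choice c = √(1 - ε²) makes √(1 - c²) equal to ε.
  obtain ⟨ρt, hρt, hP, hF⟩ :=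
    QuantumEntropy.exists_close_fidelity_le hρ hρ' (Real.sqrt_nonneg _) hc1
  refine ⟨ρt, hρt, ?_, ?_⟩
  · rw [Real.sq_sqrt h0, sub_sub_cancel, Real.sqrt_sq hε.le] at hP
    exact hP.trans (add_le_add_right hclose ε)
  · exact iSup₂_le fun ω hω =>
      QuantumEntropy.log₂_le_log₂_add (one_div_pos.2 (sub_pos.2 hc1)) (hF ω hω)
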